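/- Let $p$ be a prime number, let $\mathbb Z_{(p)}\subset\mathbb Q$ be the localization of $\mathbb Z$ at the prime ideal $p\mathbb Z$, and let $R=\mathbb Z_{(p)}+X\mathbb Q[[X]]$ be the ring of all power series over $\mathbb Q$ whose constant coefficient lies in $\mathbb Z_{(p)}$. Definitions. A valuation ring is a commutative ring $S$ with $1\neq 0$ whose ideals are totally ordered by inclusion; let $P$ be its maximal ideal. The $S$-topology of a commutative ring $S$ is the linear topology in which the non-zero ideals are neighbourhoods of $0$. A valuation ring $S$ is maximal if $S/A$ is complete in the $S/A$-topology for each proper ideal $A$ of $S$ such that $A\neq Pa$ for all $0\neq a\in S$. For a module $M$ over a domain $S$, a submodule $N$ is pure if $rN=rM\cap N$ for all $r\in S$; a module is uniserial if its submodules are totally ordered by inclusion; a torsion-free module is separable if each of its pure uniserial submodules is a direct summand. Then $R$ is a valuation domain. Let $P$ be its maximal ideal and $J=\bigcap_{n\in\mathbb N}P^n$. Then: 1. $J=X\mathbb Q[[X]]$, $J$ is a prime ideal, $R/J\cong\mathbb Z_{(p)}$ as rings, and $R_J\cong\mathbb Q[[X]]$ as $R$-algebras; 2. $R_J$ is maximal;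 3. $R$ is neither maximal nor a discrete valuation ring of rank one; 4. the $R$-module $R^\Lambda$ is separable for every index set $\Lambda$. Consequently, it is not true that every valuation domain $S$ such that $S^\Lambda$ is separable for every index set $\Lambda$ is maximal or a discrete valuation ring of rank one. -/

import Mathlib

open scoped Pointwise PowerSeries

universe u

/-- The uniform structure of the `S`-topology of a commutative ring `S`: the additive uniform
structure of the linear topology in which the non-zero ideals are neighbourhoods of `0`. It is the
coarsest one for which all maps `S → S ⧸ I` with `I ≠ 0` are uniformly continuous, `S ⧸ I` being
discrete; i.e. its entourages are generated by the sets `{(x, y) | x - y ∈ I}`, `I ≠ 0`. -/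
@[reducible]
def ringUniformSpace (S : Type*) [CommRing S] : UniformSpace S :=
  ⨅ (I : Ideal S) (_ : I ≠ ⊥), UniformSpace.comap (Ideal.Quotient.mk I) ⊥

/-- Every non-zero ideal is a neighbourhood of `0`, and over a non-trivial ring whose ideals are
totally ordered these ideals form a basis of neighbourhoods of `0`. -/
theorem ringUniformSpace_nhds_zero (S : Type*) [CommRing S] [Nontrivial S] [PreValuationRing S] :
    (@nhds S (ringUniformSpace S).toTopologicalSpace 0).HasBasis
      (fun I : Ideal S => I ≠ ⊥) (fun I => (I : Set S)) := by
  have key : @nhds S (ringUniformSpace S).toTopologicalSpace 0 =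
      ⨅ I : {I : Ideal S // I ≠ ⊥}, Filter.principal (I.1 : Set S) := by
    rw [ringUniformSpace, UniformSpace.toTopologicalSpace_iInf, nhds_iInf, iInf_subtype]
    refine iInf_congr fun I => ?_
    rw [UniformSpace.toTopologicalSpace_iInf, nhds_iInf]
    refine iInf_congr fun hI => ?_
    let _ : UniformSpace (S ⧸ I) := ⊥
    have h0 : @nhds S (UniformSpace.comap (Ideal.Quotient.mk I) ⊥).toTopologicalSpace 0 =
        Filter.comap (Ideal.Quotient.mk I) (pure (Ideal.Quotient.mk I 0)) := by
      rw [UniformSpace.toTopologicalSpace_comap, nhds_induced]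
      have : DiscreteTopology (S ⧸ I) := ⟨rfl⟩
      rw [nhds_discrete]
    rw [h0, ← Filter.principal_singleton, Filter.comap_principal]
    congr 1
    ext x
    simp [Ideal.Quotient.eq_zero_iff_mem]
  have : Nonempty {I : Ideal S // I ≠ ⊥} := ⟨⟨⊤, top_ne_bot⟩⟩
  rw [key]
  refine ⟨fun t => ?_⟩
  rw [Filter.mem_iInf_of_directed]
  · simp
  · intro I K
    rcases (PreValuationRing.iff_ideal_total.mp ‹_›).total I.1 K.1 with h | h
    · exact ⟨I, by simp, by simpa using h⟩
    · exact ⟨K, by simpa using h, by simp⟩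

/-- A *maximal* valuation ring: a ring whose ideals are totally ordered (`PreValuationRing`), with
maximal ideal `P`, such that `S ⧸ A` is complete in the `S ⧸ A`-topology for every proper ideal `A`
that is not of the form `P a` with `a ≠ 0`. -/
structure IsMaximalValuationRing (S : Type*) [CommRing S] [IsLocalRing S] : Prop where
  preValuationRing : PreValuationRing S
  complete : ∀ A : Ideal S, A ≠ ⊤ →
    (∀ a : S, a ≠ 0 → A ≠ IsLocalRing.maximalIdeal S * Ideal.span {a}) →
    @CompleteSpace (S ⧸ A) (ringUniformSpace (S ⧸ A))

/-- A module whose submodules are totally ordered by inclusion. -/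
def IsUniserialModule (S M : Type*) [CommRing S] [AddCommGroup M] [Module S M] : Prop :=
  ∀ A B : Submodule S M, A ≤ B ∨ B ≤ A

/-- `N` is pure in `M` if `r N = r M ∩ N` for all `r`. -/
def IsPureSubmodule {S M : Type*} [CommRing S] [AddCommGroup M] [Module S M]
    (N : Submodule S M) : Prop :=
  ∀ r : S, r • N = (r • (⊤ : Submodule S M)) ⊓ N

/-- A torsion-free module is separable if each pure uniserial submodule is a direct summand. -/
def IsSeparableModule (S M : Type*) [CommRing S] [IsDomain S] [AddCommGroup M] [Module S M]
    [Module.IsTorsionFree S M] : Prop :=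
  ∀ U : Submodule S M, IsPureSubmodule U → IsUniserialModule S U →
    ∃ V : Submodule S M, IsCompl U V

/-- The ideal `J = ⋂ₙ Pⁿ`, where `P` is the maximal ideal. -/
def idealJ (S : Type*) [CommRing S] [IsLocalRing S] : Ideal S :=
  ⨅ n : ℕ, IsLocalRing.maximalIdeal S ^ n

/-- The ideal `pℤ` of `ℤ`. -/
abbrev pIdeal (p : ℕ) : Ideal ℤ := Ideal.span {(p : ℤ)}

instance pIdeal_isPrime (p : ℕ) [hp : Fact p.Prime] : (pIdeal p).IsPrime :=
  (Ideal.span_singleton_prime (by exact_mod_cast hp.out.ne_zero)).mpr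
    (Nat.prime_iff_prime_int.mp hp.out)

/-- The localization of `ℤ` at the prime ideal `pℤ`, as a subring of `ℚ`. -/
noncomputable def zLoc (p : ℕ) [Fact p.Prime] : Subring ℚ :=
  (Localization.subalgebra.ofField ℚ (pIdeal p).primeCompl
    (pIdeal p).primeCompl_le_nonZeroDivisors).toSubring

/-- The ring `ℤ_(p) + X ℚ⟦X⟧` of power series over `ℚ` with constant coefficient in `ℤ_(p)`. -/
noncomputable def exampleRing (p : ℕ) [Fact p.Prime] : Subring ℚ⟦X⟧ :=
  (zLoc p).comap (PowerSeries.constantCoeff (R := ℚ))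

theorem mem_exampleRing_iff (p : ℕ) [Fact p.Prime] (f : ℚ⟦X⟧) :
    f ∈ exampleRing p ↔
      ∃ a ∈ zLoc p, ∃ g : ℚ⟦X⟧, f = PowerSeries.C a + PowerSeries.X * g := by
  constructor
  · intro h
    obtain ⟨g, hg⟩ := PowerSeries.X_dvd_iff.mpr
      (show PowerSeries.constantCoeff (f - PowerSeries.C (PowerSeries.constantCoeff f)) = 0 by simp)
    exact ⟨_, h, g, by rw [← hg]; ring⟩
  · rintro ⟨a, ha, g, rfl⟩
    simpa [exampleRing] using ha

open PowerSeries

/-!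
Let `R = ℤ_(p) + X ℚ⟦X⟧`. A non-zero element of `R` is determined up to a unit by its order in `X`
and the `p`-adic size of its leading coefficient, and divisibility in `R` compares these two data
lexicographically (`exampleRing_dvd_of_eq_X_pow_mul`); so `R` is a valuation ring with maximal ideal
`p R`, and `J = ⋂ₙ pⁿ R` is `X ℚ⟦X⟧`, the kernel of the constant coefficient `R → ℤ_(p)`. Inverting
the elements outside `J` makes all non-zero constants invertible and gives `ℚ⟦X⟧`.

The ring `ℚ⟦X⟧` is maximal because it is a complete discrete valuation ring: its only ideal to be
tested is `0`. The ring `R` is not, because `R ⧸ J ≅ ℤ_(p)` is not `p`-adically complete: the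
integers `x₀ = 0`, `xₙ₊₁ = xₙ² + p` form a Cauchy sequence whose limit would be a rational root of
`x² - x + p`, a polynomial of negative discriminant. It is not a discrete valuation ring
because `J ≠ 0`.

For separability, let `U` be a non-zero pure uniserial submodule of `R^Λ`. It has rank one, so it is
enough to find an endomorphism of `R^Λ` with values in `U` that fixes one non-zero `u ∈ U`
(`exists_isCompl_of_fixed_ne_zero`). Write `u = Xⁿ z` with `n` maximal, and let `z₀ ≠ 0` be
the family of constant coefficients of `z`.
* If `z₀` is `p`-adically bounded, it attains its largest absolute value at some `j`. Then `u j`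
  divides all coordinates of `u`, so `U` is generated by a vector with `j`-th coordinate `1` and is
  split off by that coordinate.
* If `z₀` is unbounded, then `U = J z`. Linear algebra over `ℚ` gives a linear form `φ` on `ℚ^Λ` that
  vanishes on all bounded families but not at `z₀`. Applied coefficientwise, it is a `ℚ⟦X⟧`-linear
  form `Φ` on `ℚ⟦X⟧^Λ`. It maps `R^Λ` into `J`, as the constant coefficients of an element of `R^Λ`
  are bounded, while `Φ z` is a unit. Hence `m ↦ Φ(m) Φ(z)⁻¹ z` is a projection of `R^Λ` onto `J z`.
-/

/-! ### Divisibility in `ℤ_(p) + X ℚ⟦X⟧` -/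

section ArithmeticOfExampleRing

variable {p : ℕ} [Fact p.Prime]

theorem mem_zLoc_iff (q : ℚ) : q ∈ zLoc p ↔ padicNorm p q ≤ 1 := by
  have mem_primeCompl (s : ℤ) : s ∈ (pIdeal p).primeCompl ↔ ¬ (p : ℤ) ∣ s := by
    rw [Ideal.mem_primeCompl_iff, Ideal.mem_span_singleton]
  constructor
  · rintro ⟨a, s, hs, rfl⟩
    have hs1 : padicNorm p s = 1 := (padicNorm.int_eq_one_iff s).2 ((mem_primeCompl s).1 hs)
    have := padicNorm.of_int (p := p) a
    rw [← div_eq_mul_inv, padicNorm.div]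
    simpa [hs1] using this
  · intro h
    refine ⟨q.num, q.den, (mem_primeCompl _).2 fun hd => ?_, ?_⟩
    · have hn : ¬ (p : ℤ) ∣ q.num := fun hn =>
        (Fact.out : p.Prime).one_lt.ne' (Nat.dvd_one.1 (q.reduced ▸
          Nat.dvd_gcd (Int.natCast_dvd.1 hn) (Int.natCast_dvd_natCast.1 hd)))
      rw [← Rat.num_div_den q, padicNorm.div, (padicNorm.int_eq_one_iff _).2 hn] at h
      have h1 : padicNorm p (q.den : ℚ) < 1 :=
        (padicNorm.nat_lt_one_iff _).2 (Int.natCast_dvd_natCast.1 hd)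
      have h0 : 0 < padicNorm p (q.den : ℚ) :=
        lt_of_le_of_ne (padicNorm.nonneg _) (padicNorm.nonzero (by simp)).symm
      rw [div_le_one h0] at h
      exact absurd h1 (not_lt.2 h)
    · simp [← div_eq_mul_inv, Rat.num_div_den]

theorem mem_exampleRing_iff_padicNorm (f : ℚ⟦X⟧) :
    f ∈ exampleRing p ↔ padicNorm p (constantCoeff f) ≤ 1 :=
  mem_zLoc_iff _

theorem mem_exampleRing_of_constantCoeff_eq_zero {f : ℚ⟦X⟧} (h : constantCoeff f = 0) :
    f ∈ exampleRing p := by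
  simp [mem_exampleRing_iff_padicNorm, h]

theorem X_mem_exampleRing : (X : ℚ⟦X⟧) ∈ exampleRing p :=
  mem_exampleRing_of_constantCoeff_eq_zero constantCoeff_X

/-- Divisibility in `exampleRing p` of elements written as `Xⁿ` times a power series: if `u` has
order `0`, it is decided by the `p`-adic size of the constant coefficients of the cofactors. -/
theorem exampleRing_dvd_of_eq_X_pow_mul {f g : exampleRing p} (n : ℕ) {u w : ℚ⟦X⟧}
    (hf : (f : ℚ⟦X⟧) = X ^ n * u) (hg : (g : ℚ⟦X⟧) = X ^ n * w) (hu : constantCoeff u ≠ 0)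
    (h : padicNorm p (constantCoeff w) ≤ padicNorm p (constantCoeff u)) : f ∣ g := by
  have hpos : 0 < padicNorm p (constantCoeff u) :=
    lt_of_le_of_ne (padicNorm.nonneg _) (padicNorm.nonzero hu).symm
  refine ⟨⟨w * u⁻¹, ?_⟩, Subtype.ext ?_⟩
  · rw [mem_exampleRing_iff_padicNorm, map_mul, constantCoeff_inv, ← div_eq_mul_inv,
      padicNorm.div]
    exact (div_le_one hpos).2 h
  · simp only [Subring.coe_mul, hf, hg]
    linear_combination (-(X ^ n * w)) * PowerSeries.mul_inv_cancel u hu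

theorem exists_eq_X_pow_mul_of_ne_zero {k : Type*} [Field k] {f : k⟦X⟧} (hf : f ≠ 0) :
    ∃ u : k⟦X⟧, f = X ^ f.order.toNat * u ∧ constantCoeff u ≠ 0 :=
  ⟨divXPowOrder f, X_pow_order_mul_divXPowOrder.symm,
    ((isUnit_iff_constantCoeff).1 (isUnit_divided_by_X_pow_order hf)).ne_zero⟩

instance exampleRing_valuationRing : ValuationRing (exampleRing p) := by
  rw [ValuationRing.iff_dvd_total]
  suffices key : ∀ f g : exampleRing p, f ≠ 0 → g ≠ 0 →
      (f : ℚ⟦X⟧).order.toNat ≤ (g : ℚ⟦X⟧).order.toNat → f ∣ g ∨ g ∣ f by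
    refine ⟨fun f g => ?_⟩
    by_cases hf : f = 0
    · exact Or.inr (hf ▸ dvd_zero g)
    by_cases hg : g = 0
    · exact Or.inl (hg ▸ dvd_zero f)
    rcases le_total (f : ℚ⟦X⟧).order.toNat (g : ℚ⟦X⟧).order.toNat with h | h
    · exact key f g hf hg h
    · exact (key g f hg hf h).symm
  intro f g hf hg hfg
  obtain ⟨u, hu, hu0⟩ := exists_eq_X_pow_mul_of_ne_zero (Subtype.coe_ne_coe.2 hf)
  obtain ⟨w, hw, -⟩ := exists_eq_X_pow_mul_of_ne_zero (Subtype.coe_ne_coe.2 hg)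
  obtain ⟨k, hk⟩ := Nat.exists_eq_add_of_le hfg
  rw [hk, pow_add, mul_assoc] at hw
  rcases le_or_gt (padicNorm p (constantCoeff (X ^ k * w))) (padicNorm p (constantCoeff u))
    with h | h
  · exact Or.inl (exampleRing_dvd_of_eq_X_pow_mul _ hu hw hu0 h)
  · refine Or.inr (exampleRing_dvd_of_eq_X_pow_mul _ hw hu (fun h0 => ?_) h.le)
    rw [h0, padicNorm.zero] at h
    exact absurd h (not_lt.2 (padicNorm.nonneg _))

theorem padicNorm_pow_natCast (n : ℕ) : padicNorm p ((p : ℚ) ^ n) = (p : ℚ) ^ (-n : ℤ) := by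
  induction n with
  | zero => simp
  | succ n ih =>
    rw [pow_succ, padicNorm.mul, ih, padicNorm.padicNorm_p_of_prime]
    have : (p : ℚ) ≠ 0 := by exact_mod_cast (Fact.out : p.Prime).ne_zero
    rw [← zpow_neg_one, ← zpow_add₀ this]
    push_cast
    ring_nf

theorem constantCoeff_natCast (n : ℕ) : constantCoeff (n : ℚ⟦X⟧) = n := map_natCast _ n

theorem prime_pow_dvd_iff (n : ℕ) (f : exampleRing p) :
    (p : exampleRing p) ^ n ∣ f ↔ padicNorm p (constantCoeff (f : ℚ⟦X⟧)) ≤ (p : ℚ) ^ (-n : ℤ) := by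
  have hp : (p : ℚ) ≠ 0 := by exact_mod_cast (Fact.out : p.Prime).ne_zero
  constructor
  · rintro ⟨g, rfl⟩
    have hg := (mem_exampleRing_iff_padicNorm (p := p) _).1 g.2
    simp only [Subring.coe_mul, Subring.coe_pow, Subring.coe_natCast, map_mul, map_pow,
      constantCoeff_natCast, padicNorm.mul, padicNorm_pow_natCast]
    exact mul_le_of_le_one_right (by positivity) hg
  · intro h
    refine exampleRing_dvd_of_eq_X_pow_mul 0 (u := (p : ℚ⟦X⟧) ^ n) (w := f)
      (by simp) (by simp) ?_ ?_
    · rw [map_pow, constantCoeff_natCast]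
      exact pow_ne_zero n hp
    · simpa [constantCoeff_natCast, padicNorm_pow_natCast] using h

theorem exists_zpow_lt_padicNorm {q : ℚ} (hq : q ≠ 0) :
    ∃ n : ℕ, (p : ℚ) ^ (-n : ℤ) < padicNorm p q := by
  have hp := (Fact.out : p.Prime).one_lt
  have hpos : 0 < padicNorm p q := lt_of_le_of_ne (padicNorm.nonneg _) (padicNorm.nonzero hq).symm
  obtain ⟨n, hn⟩ := exists_pow_lt_of_lt_one hpos
    (show ((p : ℚ)⁻¹) < 1 from inv_lt_one_of_one_lt₀ (by exact_mod_cast hp))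
  exact ⟨n, by simpa [zpow_neg] using hn⟩

/-- The elements of `X ℚ⟦X⟧` are those divisible by all powers of `p`. -/
theorem forall_prime_pow_dvd_iff (f : exampleRing p) :
    (∀ n : ℕ, (p : exampleRing p) ^ n ∣ f) ↔ constantCoeff (f : ℚ⟦X⟧) = 0 := by
  simp only [prime_pow_dvd_iff]
  constructor
  · intro h
    by_contra h0
    obtain ⟨n, hn⟩ := exists_zpow_lt_padicNorm (p := p) h0
    exact absurd (h n) (not_le.2 hn)
  · intro h n
    rw [h, padicNorm.zero]
    positivity

theorem isUnit_exampleRing_iff (f : exampleRing p) :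
    IsUnit f ↔ ¬ (p : exampleRing p) ∣ f := by
  have hlt : padicNorm p (constantCoeff (f : ℚ⟦X⟧)) < 1 ↔ (p : exampleRing p) ∣ f := by
    have h1 := prime_pow_dvd_iff 1 f
    rw [pow_one] at h1
    rw [h1]
    have hp : (1 : ℚ) < p := by exact_mod_cast (Fact.out : p.Prime).one_lt
    constructor
    · intro h
      by_cases h0 : constantCoeff (f : ℚ⟦X⟧) = 0
      · rw [h0, padicNorm.zero]; positivity
      obtain ⟨z, hz⟩ := padicNorm.values_discrete (p := p) h0
      rw [hz] at h ⊢
      have := (zpow_lt_one_iff_right₀ hp).1 h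
      exact zpow_le_zpow_right₀ hp.le (by push_cast; lia)
    · intro h
      exact h.trans_lt ((zpow_lt_one_iff_right₀ hp).2 (by simp))
  rw [← hlt, not_lt, isUnit_iff_dvd_one]
  constructor
  · rintro ⟨g, hg⟩
    have hg1 := (mem_exampleRing_iff_padicNorm (p := p) _).1 g.2
    have hmul : padicNorm p (constantCoeff (f : ℚ⟦X⟧)) * padicNorm p (constantCoeff (g : ℚ⟦X⟧))
        = 1 := by
      rw [← padicNorm.mul, ← map_mul, ← Subring.coe_mul, ← hg]
      simp
    calc (1 : ℚ) = _ := hmul.symm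
      _ ≤ _ := mul_le_of_le_one_right (padicNorm.nonneg _) hg1
  · intro h
    refine exampleRing_dvd_of_eq_X_pow_mul 0 (u := f) (w := 1) (by simp) (by simp) ?_ (by simpa)
    intro h0
    rw [h0, padicNorm.zero] at h
    exact absurd h (by norm_num)

theorem maximalIdeal_exampleRing :
    IsLocalRing.maximalIdeal (exampleRing p) = Ideal.span {(p : exampleRing p)} := by
  ext f
  rw [IsLocalRing.mem_maximalIdeal, mem_nonunits_iff, isUnit_exampleRing_iff, not_not,
    Ideal.mem_span_singleton]

theorem mem_idealJ_iff (f : exampleRing p) :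
    f ∈ idealJ (exampleRing p) ↔ constantCoeff (f : ℚ⟦X⟧) = 0 := by
  simp only [idealJ, Submodule.mem_iInf, maximalIdeal_exampleRing, Ideal.span_singleton_pow,
    Ideal.mem_span_singleton]
  exact forall_prime_pow_dvd_iff f

end ArithmeticOfExampleRing

/-! ### The residue ring at `J` and the localization at `J` -/

section ResidueAndLocalization

variable (p : ℕ) [Fact p.Prime]

/-- The constant coefficient, as a ring homomorphism from `ℤ_(p) + X ℚ⟦X⟧` onto `ℤ_(p)`. -/
noncomputable def constantCoeffHom : exampleRing p →+* zLoc p :=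
  (constantCoeff (R := ℚ)).restrict (exampleRing p) (zLoc p) fun _ h => h

theorem constantCoeffHom_surjective : Function.Surjective (constantCoeffHom p) := fun a =>
  ⟨⟨C (a : ℚ), by simp [exampleRing]⟩, Subtype.ext (constantCoeff_C (a : ℚ))⟩

theorem ker_constantCoeffHom : RingHom.ker (constantCoeffHom p) = idealJ (exampleRing p) := by
  ext f
  rw [RingHom.mem_ker, mem_idealJ_iff, ← Subtype.coe_inj]
  rfl

instance idealJ_exampleRing_isPrime : (idealJ (exampleRing p)).IsPrime :=
  ker_constantCoeffHom p ▸ RingHom.ker_isPrime _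

theorem nonempty_quotient_idealJ_equiv :
    Nonempty ((exampleRing p ⧸ idealJ (exampleRing p)) ≃+* Localization.AtPrime (pIdeal p)) := by
  let e : Localization.AtPrime (pIdeal p) ≃ₐ[ℤ] Localization.subalgebra.ofField ℚ
      (pIdeal p).primeCompl (pIdeal p).primeCompl_le_nonZeroDivisors :=
    IsLocalization.algEquiv (pIdeal p).primeCompl _ _
  exact ⟨((Ideal.quotEquivOfEq (ker_constantCoeffHom p).symm).trans
    (RingHom.quotientKerEquivOfSurjective (constantCoeffHom_surjective p))).trans
    e.symm.toRingEquiv⟩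

theorem powerSeries_isLocalization :
    IsLocalization.AtPrime ℚ⟦X⟧ (idealJ (exampleRing p)) := by
  refine (isLocalization_iff _ _).2 ⟨?_, ?_, ?_⟩
  · rintro ⟨f, hf⟩
    rw [Ideal.mem_primeCompl_iff, mem_idealJ_iff] at hf
    exact isUnit_iff_constantCoeff.2 (isUnit_iff_ne_zero.2 hf)
  · intro f
    -- The denominator of the constant coefficient moves `f` into `ℤ_(p) + X ℚ⟦X⟧`.
    set d := (constantCoeff f).den with hd
    refine ⟨⟨⟨f * d, ?_⟩, ⟨(d : exampleRing p), ?_⟩⟩, ?_⟩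
    · rw [mem_exampleRing_iff_padicNorm, map_mul, constantCoeff_natCast, hd, Rat.mul_den_eq_num]
      exact padicNorm.of_int _
    · rw [Ideal.mem_primeCompl_iff, mem_idealJ_iff, Subring.coe_natCast, constantCoeff_natCast]
      simp [hd]
    · rfl
  · intro f g h
    exact ⟨1, by simpa using Subtype.ext h⟩

theorem nonempty_localization_idealJ_equiv :
    Nonempty (Localization.AtPrime (idealJ (exampleRing p)) ≃ₐ[exampleRing p] ℚ⟦X⟧) :=
  have := powerSeries_isLocalization p
  ⟨IsLocalization.algEquiv (idealJ (exampleRing p)).primeCompl _ _⟩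

end ResidueAndLocalization

/-! ### Convergence and Cauchy filters in the ring topology -/

section RingTopology

variable {S : Type*} [CommRing S]

theorem le_nhds_ringUniformSpace_iff (F : Filter S) (x : S) :
    F ≤ @nhds S (ringUniformSpace S).toTopologicalSpace x ↔
      ∀ I : Ideal S, I ≠ ⊥ → {y | y - x ∈ I} ∈ F := by
  have key : @nhds S (ringUniformSpace S).toTopologicalSpace x =
      ⨅ (I : Ideal S) (_ : I ≠ ⊥), Filter.principal {y | y - x ∈ I} := by
    rw [ringUniformSpace, UniformSpace.toTopologicalSpace_iInf, nhds_iInf]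
    refine iInf_congr fun I => ?_
    rw [UniformSpace.toTopologicalSpace_iInf, nhds_iInf]
    refine iInf_congr fun _ => ?_
    let _ : UniformSpace (S ⧸ I) := ⊥
    have : DiscreteTopology (S ⧸ I) := ⟨rfl⟩
    rw [UniformSpace.toTopologicalSpace_comap, nhds_induced, nhds_discrete,
      ← Filter.principal_singleton, Filter.comap_principal]
    congr 1
    ext y
    simp [Ideal.Quotient.eq]
  rw [key]
  simp only [le_iInf_iff, Filter.le_principal_iff]

theorem cauchy_ringUniformSpace_iff (F : Filter S) :
    @Cauchy S (ringUniformSpace S) F ↔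
      F.NeBot ∧ ∀ I : Ideal S, I ≠ ⊥ → ∃ t ∈ F, ∀ x ∈ t, ∀ y ∈ t, x - y ∈ I := by
  have key : @uniformity S (ringUniformSpace S) =
      ⨅ (I : Ideal S) (_ : I ≠ ⊥), Filter.principal {q : S × S | q.1 - q.2 ∈ I} := by
    rw [ringUniformSpace, iInf_uniformity]
    refine iInf_congr fun I => ?_
    rw [iInf_uniformity]
    refine iInf_congr fun _ => ?_
    rw [uniformity_comap, bot_uniformity, Filter.comap_principal]
    congr 1
    ext ⟨x, y⟩
    exact Ideal.Quotient.eq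
  rw [@Cauchy.eq_1 S (ringUniformSpace S), key]
  simp only [le_iInf_iff, Filter.le_principal_iff, Filter.mem_prod_self_iff, Set.prod_subset_iff,
    Set.mem_ofPred_eq]

end RingTopology

/-! ### Power series rings over a field are maximal -/

section PowerSeriesMaximal

variable {k : Type*} [Field k] {T : Type*} [CommRing T]

/-- A non-zero ideal of `k⟦X⟧` contains a power of `X`. -/
theorem exists_X_pow_dvd_imp_mem (e : T ≃+* k⟦X⟧) {I : Ideal T} (hI : I ≠ ⊥) :
    ∃ n : ℕ, ∀ x : T, X ^ n ∣ e x → x ∈ I := by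
  obtain ⟨a, ha, ha0⟩ := Submodule.exists_mem_ne_zero_of_ne_bot hI
  have hea : e a ≠ 0 := (map_ne_zero_iff e e.injective).2 ha0
  refine ⟨(e a).order.toNat, fun x hx => I.mem_of_dvd ?_ ha⟩
  have hdvd : e a ∣ X ^ (e a).order.toNat :=
    (isUnit_divided_by_X_pow_order hea).dvd_mul_right.1
      (dvd_of_eq X_pow_order_mul_divXPowOrder.symm)
  simpa using map_dvd e.symm (hdvd.trans hx)

theorem completeSpace_of_ringEquiv_powerSeries (e : T ≃+* k⟦X⟧) :
    @CompleteSpace T (ringUniformSpace T) := by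
  let _ : UniformSpace T := ringUniformSpace T
  refine ⟨fun {F} hF => ?_⟩
  rw [cauchy_ringUniformSpace_iff] at hF
  obtain ⟨hne, hF⟩ := hF
  have hsets : ∀ n : ℕ, ∃ t ∈ F, ∀ x ∈ t, ∀ y ∈ t, X ^ n ∣ e x - e y := fun n => by
    have hI : (Ideal.span {(X : k⟦X⟧) ^ n}).comap (e : T →+* k⟦X⟧) ≠ ⊥ := by
      intro h
      have hmem : e.symm (X ^ n) ∈ (Ideal.span {(X : k⟦X⟧) ^ n}).comap (e : T →+* k⟦X⟧) := by
        simp [Ideal.mem_comap]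
      rw [h, Ideal.mem_bot, map_eq_zero_iff e.symm e.symm.injective] at hmem
      exact pow_ne_zero n X_ne_zero hmem
    simpa [Ideal.mem_comap, Ideal.mem_span_singleton] using hF _ hI
  choose t htF ht using hsets
  choose y hy using fun n => hne.nonempty_of_mem (htF n)
  -- The limit has as `i`-th coefficient that of any element of `t (i + 1)`.
  let s : k⟦X⟧ := PowerSeries.mk fun i => coeff i (e (y (i + 1)))
  have hs : ∀ n, X ^ n ∣ e (y n) - s := fun n => by
    rw [X_pow_dvd_iff]
    intro i hi
    obtain ⟨z, hz⟩ := hne.nonempty_of_mem (Filter.inter_mem (htF n) (htF (i + 1)))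
    have h1 := X_pow_dvd_iff.1 (ht n _ (hy n) z hz.1) i hi
    have h2 := X_pow_dvd_iff.1 (ht (i + 1) _ (hy (i + 1)) z hz.2) i (Nat.lt_succ_self i)
    rw [map_sub, sub_eq_zero] at h1 h2
    rw [map_sub, h1, ← h2, coeff_mk, sub_self]
  refine ⟨e.symm s, (le_nhds_ringUniformSpace_iff F _).2 fun I hI => ?_⟩
  obtain ⟨n, hn⟩ := exists_X_pow_dvd_imp_mem e hI
  refine Filter.mem_of_superset (htF n) fun x hx => hn _ ?_
  rw [map_sub, e.apply_symm_apply, ← sub_add_sub_cancel _ (e (y n)) s]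
  exact dvd_add (ht n x hx _ (hy n)) (hs n)

/-- The only proper ideal of `k⟦X⟧` that is not of the form `P a` with `a ≠ 0` is `0`, so
maximality reduces to completeness of `k⟦X⟧` itself. -/
theorem isMaximalValuationRing_of_ringEquiv_powerSeries [IsLocalRing T] (e : T ≃+* k⟦X⟧) :
    IsMaximalValuationRing T := by
  have : IsDomain T := e.toMulEquiv.isDomain
  have : IsDiscreteValuationRing T := IsDiscreteValuationRing.RingEquivClass.isDiscreteValuationRing e.symm
  refine ⟨inferInstance, fun A hA hAP => ?_⟩
  have hA0 : A = ⊥ := by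
    by_contra h0
    obtain ⟨ϖ, hϖ⟩ := IsDiscreteValuationRing.exists_irreducible T
    obtain ⟨n, rfl⟩ := IsDiscreteValuationRing.ideal_eq_span_pow_irreducible h0 hϖ
    cases n with
    | zero => exact hA (by simp)
    | succ n =>
      refine hAP (ϖ ^ n) (pow_ne_zero n hϖ.ne_zero) ?_
      rw [hϖ.maximalIdeal_eq, Ideal.span_singleton_mul_span_singleton, pow_succ']
  subst hA0
  exact completeSpace_of_ringEquiv_powerSeries ((RingEquiv.quotientBot T).trans e)

end PowerSeriesMaximal

/-! ### `ℤ_(p) + X ℚ⟦X⟧` is neither maximal nor a discrete valuation ring -/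

section NotMaximal

/-- The iterates of `x ↦ x² + p` starting at `0`; they converge `p`-adically to a root of
`x² - x + p`. -/
def quadraticIterate (p : ℕ) : ℕ → ℤ
  | 0 => 0
  | n + 1 => quadraticIterate p n ^ 2 + p

theorem dvd_quadraticIterate (p n : ℕ) : (p : ℤ) ∣ quadraticIterate p n := by
  induction n with
  | zero => simp [quadraticIterate]
  | succ n ih => exact dvd_add (dvd_pow ih two_ne_zero) dvd_rfl

theorem pow_dvd_quadraticIterate_succ_sub (p n : ℕ) :
    (p : ℤ) ^ n ∣ quadraticIterate p (n + 1) - quadraticIterate p n := by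
  induction n with
  | zero => simp
  | succ n ih =>
    have h : quadraticIterate p (n + 1 + 1) - quadraticIterate p (n + 1) =
        (quadraticIterate p (n + 1) - quadraticIterate p n) *
          (quadraticIterate p (n + 1) + quadraticIterate p n) := by
      simp only [quadraticIterate]; ring
    rw [h, pow_succ]
    exact mul_dvd_mul ih (dvd_add (dvd_quadraticIterate p _) (dvd_quadraticIterate p _))

theorem pow_dvd_quadraticIterate_sub (p : ℕ) {n m : ℕ} (h : n ≤ m) :
    (p : ℤ) ^ n ∣ quadraticIterate p m - quadraticIterate p n := by
  induction m, h using Nat.le_induction with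
  | base => simp
  | succ m hm ih =>
    rw [← sub_add_sub_cancel _ (quadraticIterate p m)]
    exact dvd_add ((pow_dvd_pow _ hm).trans (pow_dvd_quadraticIterate_succ_sub p m)) ih

variable (p : ℕ) [Fact p.Prime]

theorem prime_natCast_notMem_idealJ_pow (n : ℕ) :
    (p : exampleRing p) ^ n ∉ idealJ (exampleRing p) := by
  rw [mem_idealJ_iff, Subring.coe_pow, Subring.coe_natCast, map_pow, constantCoeff_natCast]
  exact pow_ne_zero n (by exact_mod_cast (Fact.out : p.Prime).ne_zero)

/-- A non-zero ideal of `R ⧸ J` contains a power of `p`. -/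
theorem exists_prime_pow_mem {I : Ideal (exampleRing p ⧸ idealJ (exampleRing p))} (hI : I ≠ ⊥) :
    ∃ n : ℕ, (p : exampleRing p ⧸ idealJ (exampleRing p)) ^ n ∈ I := by
  obtain ⟨a, ha, ha0⟩ := Submodule.exists_mem_ne_zero_of_ne_bot hI
  obtain ⟨f, rfl⟩ := Ideal.Quotient.mk_surjective a
  rw [ne_eq, Ideal.Quotient.eq_zero_iff_mem, mem_idealJ_iff, ← forall_prime_pow_dvd_iff] at ha0
  push Not at ha0
  obtain ⟨n, hn⟩ := ha0
  have hdvd := (((ValuationRing.iff_dvd_total.1 exampleRing_valuationRing).total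
    f ((p : exampleRing p) ^ n)).resolve_right hn)
  refine ⟨n, I.mem_of_dvd ?_ ha⟩
  simpa using map_dvd (Ideal.Quotient.mk (idealJ (exampleRing p))) hdvd

/-- `R ⧸ J ≅ ℤ_(p)` is not complete: the limit of the iterates would be a rational root of
`x² - x + p`, which has no real root. -/
theorem not_completeSpace_quotient_idealJ :
    ¬ @CompleteSpace (exampleRing p ⧸ idealJ (exampleRing p)) (ringUniformSpace _) := by
  intro hc
  let Q := exampleRing p ⧸ idealJ (exampleRing p)
  let x : ℕ → Q := fun n => (quadraticIterate p n : Q)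
  have hsub {n m k : ℕ} (hm : n ≤ m) (hk : n ≤ k) : (p : Q) ^ n ∣ x m - x k := by
    have h := dvd_sub (pow_dvd_quadraticIterate_sub p hm) (pow_dvd_quadraticIterate_sub p hk)
    rw [sub_sub_sub_cancel_right] at h
    simpa [x] using map_dvd (Int.castRingHom Q) h
  have hF : @Cauchy Q (ringUniformSpace Q) (Filter.map x Filter.atTop) := by
    refine (cauchy_ringUniformSpace_iff _).2 ⟨inferInstance, fun I hI => ?_⟩
    obtain ⟨n, hn⟩ := exists_prime_pow_mem p hI
    refine ⟨x '' Set.Ici n, Filter.image_mem_map (Filter.Ici_mem_atTop n), ?_⟩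
    rintro _ ⟨m, hm, rfl⟩ _ ⟨k, hk, rfl⟩
    exact I.mem_of_dvd (hsub hm hk) hn
  obtain ⟨y, hy⟩ := hc.complete hF
  rw [le_nhds_ringUniformSpace_iff] at hy
  obtain ⟨f, rfl⟩ := Ideal.Quotient.mk_surjective y
  have hroot : ∀ n : ℕ, (p : exampleRing p) ^ n ∣ f ^ 2 - f + p := fun n => by
    have hI : Ideal.span {(p : Q) ^ n} ≠ ⊥ := by
      rw [ne_eq, Ideal.span_singleton_eq_bot]
      have h0 := prime_natCast_notMem_idealJ_pow p n
      rw [← Ideal.Quotient.eq_zero_iff_mem] at h0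
      simpa using h0
    obtain ⟨m, hm⟩ := Filter.eventually_atTop.1 (Filter.mem_map.1 (hy _ hI))
    have h1 : (p : Q) ^ n ∣ x (max m n) - Ideal.Quotient.mk _ f :=
      Ideal.mem_span_singleton.1 (hm _ (le_max_left m n))
    have h2 : (p : Q) ^ n ∣ x (max m n + 1) - x (max m n) :=
      hsub ((le_max_right m n).trans (Nat.le_succ _)) (le_max_right m n)
    have h3 : x (max m n + 1) = x (max m n) ^ 2 + p := by simp [x, quadraticIterate]
    have h4 : (p : Q) ^ n ∣ Ideal.Quotient.mk _ (f ^ 2 - f + p) := by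
      have h5 : Ideal.Quotient.mk (idealJ (exampleRing p)) (f ^ 2 - f + p) =
          (x (max m n + 1) - x (max m n)) - (x (max m n) - Ideal.Quotient.mk _ f) *
            (x (max m n) + Ideal.Quotient.mk _ f - 1) := by
        rw [h3]
        simp only [map_add, map_sub, map_pow, map_natCast]
        ring
      rw [h5]
      exact dvd_sub h2 (h1.mul_right _)
    obtain ⟨c, hc⟩ := h4
    obtain ⟨g, rfl⟩ := Ideal.Quotient.mk_surjective c
    have h6 : f ^ 2 - f + p - (p : exampleRing p) ^ n * g ∈ idealJ (exampleRing p) := by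
      rw [← Ideal.Quotient.eq_zero_iff_mem, map_sub, hc]
      simp
    have h7 := (forall_prime_pow_dvd_iff _).2 ((mem_idealJ_iff _).1 h6) n
    exact (dvd_sub_left (Dvd.intro g rfl)).1 h7
  have h0 := (forall_prime_pow_dvd_iff _).1 hroot
  simp only [Subring.coe_add, AddSubgroupClass.coe_sub, Subring.coe_pow, Subring.coe_natCast, map_add,
    map_sub, map_pow, constantCoeff_natCast] at h0
  have hp : (1 : ℚ) ≤ p := by exact_mod_cast (Fact.out : p.Prime).one_le
  nlinarith [sq_nonneg (constantCoeff (f : ℚ⟦X⟧) - 1 / 2)]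

/-- `J` is not principal, since it is divisible by `p`. -/
theorem idealJ_ne_maximalIdeal_mul_span (a : exampleRing p) :
    idealJ (exampleRing p) ≠ IsLocalRing.maximalIdeal (exampleRing p) * Ideal.span {a} := by
  rw [maximalIdeal_exampleRing, Ideal.span_singleton_mul_span_singleton]
  intro h
  have hp : (p : ℚ) ≠ 0 := by exact_mod_cast (Fact.out : p.Prime).ne_zero
  have hpa : (p : exampleRing p) * a ∈ idealJ (exampleRing p) :=
    h ▸ Ideal.mem_span_singleton_self _
  have ha : a ∈ idealJ (exampleRing p) :=
    ((idealJ_exampleRing_isPrime p).mem_or_mem hpa).resolve_left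
      (by simpa using prime_natCast_notMem_idealJ_pow p 1)
  obtain ⟨c, hc⟩ := Ideal.mem_span_singleton.1 (h ▸ ha)
  have ha0 : a = 0 := by
    by_contra ha0
    have : (p : exampleRing p) * c = 1 :=
      mul_left_cancel₀ ha0 (by linear_combination -hc)
    exact (isUnit_exampleRing_iff (p := p) p).1 (IsUnit.of_mul_eq_one _ this) dvd_rfl
  have hX : (⟨X, X_mem_exampleRing⟩ : exampleRing p) ∈ idealJ (exampleRing p) :=
    (mem_idealJ_iff _).2 constantCoeff_X
  rw [h, ha0, mul_zero, Ideal.mem_span_singleton, zero_dvd_iff] at hX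
  exact X_ne_zero (congrArg Subtype.val hX)

theorem not_isMaximalValuationRing_exampleRing : ¬ IsMaximalValuationRing (exampleRing p) :=
  fun h => not_completeSpace_quotient_idealJ p <| h.complete _
    (idealJ_exampleRing_isPrime p).ne_top fun a _ => idealJ_ne_maximalIdeal_mul_span p a

theorem not_isDiscreteValuationRing_exampleRing : ¬ IsDiscreteValuationRing (exampleRing p) := by
  intro h
  have hX : (⟨X, X_mem_exampleRing⟩ : exampleRing p) ∈ idealJ (exampleRing p) :=
    (mem_idealJ_iff _).2 constantCoeff_X
  rw [idealJ, Ideal.iInf_pow_eq_bot_of_isLocalRing _ (IsLocalRing.maximalIdeal.isMaximal _).ne_top,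
    Ideal.mem_bot] at hX
  exact X_ne_zero (congrArg Subtype.val hX)

end NotMaximal

/-! ### Separability of the powers of `ℤ_(p) + X ℚ⟦X⟧` -/

section Separability

/-- A pure uniserial submodule has rank one, so an endomorphism with values in it that fixes one of
its non-zero elements is a projection onto it. -/
theorem exists_isCompl_of_fixed_ne_zero {S M : Type*} [CommRing S] [IsDomain S] [AddCommGroup M]
    [Module S M] [Module.IsTorsionFree S M] {U : Submodule S M} (hU : IsUniserialModule S U)
    (π : M →ₗ[S] M) (hπ : ∀ m, π m ∈ U) {u : M} (huU : u ∈ U) (hu0 : u ≠ 0) (hu : π u = u) :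
    ∃ V : Submodule S M, IsCompl U V := by
  refine ⟨LinearMap.ker (π.codRestrict U hπ), LinearMap.isCompl_of_proj fun m => Subtype.ext ?_⟩
  rw [LinearMap.codRestrict_apply]
  have mem_of_le {x y : U} (h : Submodule.span S {x} ≤ Submodule.span S {y}) :
      ∃ a : S, a • (y : M) = x := by
    obtain ⟨a, ha⟩ := Submodule.mem_span_singleton.1 (h (Submodule.mem_span_singleton_self x))
    exact ⟨a, congrArg Subtype.val ha⟩
  rcases hU (Submodule.span S {m}) (Submodule.span S {⟨u, huU⟩}) with h | h
  · obtain ⟨a, ha⟩ := mem_of_le h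
    rw [← ha, map_smul, hu]
  · obtain ⟨a, ha⟩ := mem_of_le h
    have ha0 : a ≠ 0 := by
      rintro rfl
      exact hu0 (by simpa using ha.symm)
    refine smul_right_injective M ha0 ?_
    simp only at ha ⊢
    rw [← map_smul, ha, hu]

theorem IsPureSubmodule.mem_of_smul_mem {S M : Type*} [CommRing S] [IsDomain S] [AddCommGroup M]
    [Module S M] [Module.IsTorsionFree S M] {U : Submodule S M} (hU : IsPureSubmodule U)
    {r : S} (hr : r ≠ 0) {m : M} (h : r • m ∈ U) : m ∈ U := by
  have hm : r • m ∈ r • U := by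
    rw [hU r]
    exact ⟨Submodule.smul_mem_pointwise_smul m r ⊤ trivial, h⟩
  obtain ⟨m', hm', heq⟩ := (Submodule.mem_smul_pointwise_iff_exists _ _ _).1 hm
  exact smul_right_injective M hr heq ▸ hm'

/-- A non-zero element of a pure uniserial submodule of `S^Λ` one of whose coordinates divides all
others makes that submodule a direct summand. -/
theorem exists_isCompl_of_coordinate_dvd {S : Type*} [CommRing S] [IsDomain S] {Λ : Type*}
    {U : Submodule S (Λ → S)} (hp : IsPureSubmodule U) (hU : IsUniserialModule S U)
    {u : Λ → S} (hu : u ∈ U) {i : Λ} (hi : u i ≠ 0) (hdvd : ∀ j, u i ∣ u j) :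
    ∃ V : Submodule S (Λ → S), IsCompl U V := by
  choose w hw using hdvd
  have huw : u i • w = u := funext fun j => (hw j).symm
  have hwU : w ∈ U := hp.mem_of_smul_mem hi (huw.symm ▸ hu)
  refine exists_isCompl_of_fixed_ne_zero hU ((LinearMap.proj i : (Λ → S) →ₗ[S] S).smulRight w)
    (fun m => U.smul_mem _ hwU) hu (fun h => hi (congrFun h i)) huw

/-- The coefficientwise extension `(Λ → k)⟦X⟧ → k⟦X⟧` of a linear form `Λ → k`; the source is
written as `Λ → k⟦X⟧`. -/
noncomputable def coeffwiseMap {k Λ : Type*} [Field k] (φ : (Λ → k) →ₗ[k] k) : (Λ → k⟦X⟧) →ₗ[k⟦X⟧] k⟦X⟧ where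
  toFun m := PowerSeries.mk fun n => φ fun i => coeff n (m i)
  map_add' m m' := by
    ext n
    simp only [coeff_mk, map_add, Pi.add_apply]
    exact map_add φ _ _
  map_smul' c m := by
    ext n
    simp only [coeff_mk, RingHom.id_apply, smul_eq_mul, coeff_mul, Pi.smul_apply]
    have h : (fun i => ∑ x ∈ Finset.HasAntidiagonal.antidiagonal n, coeff x.1 c * coeff x.2 (m i)) =
        ∑ x ∈ Finset.HasAntidiagonal.antidiagonal n, coeff x.1 c • fun i => coeff x.2 (m i) := by
      ext i
      simp
    rw [h, map_sum]
    simp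

theorem constantCoeff_coeffwiseMap {k Λ : Type*} [Field k] (φ : (Λ → k) →ₗ[k] k)
    (m : Λ → k⟦X⟧) : constantCoeff (coeffwiseMap φ m) = φ fun i => constantCoeff (m i) := by
  rw [← coeff_zero_eq_constantCoeff_apply]
  simp [coeffwiseMap]

variable (p : ℕ) [Fact p.Prime]

/-- The `ℚ`-subspace of `ℚ^Λ` of families that are bounded for the `p`-adic absolute value. -/
def boundedFamilies (Λ : Type*) : Submodule ℚ (Λ → ℚ) where
  carrier := {v | ∃ b : ℚ, ∀ i, padicNorm p (v i) ≤ b}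
  zero_mem' := ⟨0, fun _ => by simp⟩
  add_mem' := by
    rintro v w ⟨b, hb⟩ ⟨c, hc⟩
    exact ⟨max b c, fun i => padicNorm.nonarchimedean.trans (max_le_max (hb i) (hc i))⟩
  smul_mem' := by
    rintro r v ⟨b, hb⟩
    refine ⟨padicNorm p r * b, fun i => ?_⟩
    rw [Pi.smul_apply, smul_eq_mul, padicNorm.mul]
    exact mul_le_mul_of_nonneg_left (hb i) (padicNorm.nonneg _)

variable {p}

/-- The `p`-adic absolute value is discrete, so a bounded family attains its largest value. -/
theorem exists_max_padicNorm {Λ : Type*} {v : Λ → ℚ} (hv : v ∈ boundedFamilies p Λ) {i : Λ}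
    (hi : v i ≠ 0) : ∃ j, v j ≠ 0 ∧ ∀ l, padicNorm p (v l) ≤ padicNorm p (v j) := by
  obtain ⟨b, hb⟩ := hv
  have hp : (1 : ℚ) < p := by exact_mod_cast (Fact.out : p.Prime).one_lt
  obtain ⟨N, hN⟩ := pow_unbounded_of_one_lt b hp
  have hbdd : ∀ z : ℤ, (∃ j, v j ≠ 0 ∧ padicValRat p (v j) = z) → -(N : ℤ) ≤ z := by
    rintro z ⟨j, hj, rfl⟩
    have h := ((hb j).trans_lt hN).le
    rw [padicNorm.eq_zpow_of_nonzero hj, ← zpow_natCast, zpow_le_zpow_iff_right₀ hp] at h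
    lia
  obtain ⟨z, ⟨j, hj, rfl⟩, hz⟩ := Int.exists_least_of_bdd ⟨_, hbdd⟩ ⟨_, i, hi, rfl⟩
  refine ⟨j, hj, fun l => ?_⟩
  by_cases hl : v l = 0
  · rw [hl, padicNorm.zero]; exact padicNorm.nonneg _
  rw [padicNorm.eq_zpow_of_nonzero hj, padicNorm.eq_zpow_of_nonzero hl]
  exact zpow_le_zpow_right₀ hp.le (neg_le_neg (hz _ ⟨l, hl, rfl⟩))

/-- A non-zero family of power series is `Xⁿ` times a family one of whose members has order `0`. -/
theorem exists_family_eq_X_pow_mul {k Λ : Type*} [Field k] {u : Λ → k⟦X⟧} (hu : u ≠ 0) :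
    ∃ (n : ℕ) (z : Λ → k⟦X⟧), (∀ i, u i = X ^ n * z i) ∧ ∃ i, constantCoeff (z i) ≠ 0 := by
  classical
  have hex : ∃ n i, u i ≠ 0 ∧ (u i).order.toNat = n := by
    obtain ⟨i, hi⟩ := Function.ne_iff.1 hu
    exact ⟨_, i, hi, rfl⟩
  obtain ⟨i, hi, hin⟩ := Nat.find_spec hex
  have hdvd : ∀ j, X ^ Nat.find hex ∣ u j := fun j => by
    by_cases hj : u j = 0
    · exact hj.symm ▸ dvd_zero _
    · exact (pow_dvd_pow X (Nat.find_min' hex ⟨j, hj, rfl⟩)).trans X_pow_order_dvd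
  choose z hz using hdvd
  refine ⟨_, z, hz, i, ?_⟩
  obtain ⟨w, hw, hw0⟩ := exists_eq_X_pow_mul_of_ne_zero hi
  rw [hin] at hw
  rwa [mul_left_cancel₀ (pow_ne_zero _ X_ne_zero) ((hz i).symm.trans hw)]

/-- If the leading coefficients of a family are `p`-adically unbounded, then the pure submodule it
generates is a direct summand. With `u = Xⁿ z`, that submodule is `J z`. A linear form on `ℚ^Λ`
which vanishes on bounded families and not on the constant coefficients of `z` extends
coefficientwise to a form `Φ` over `ℚ⟦X⟧`, which maps `R^Λ` into `J`; the projection is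
`m ↦ Φ(m) Φ(z)⁻¹ z`. -/
theorem exists_isCompl_of_unbounded {Λ : Type*} {U : Submodule (exampleRing p) (Λ → exampleRing p)}
    (hp : IsPureSubmodule U) (hU : IsUniserialModule (exampleRing p) U)
    {u : Λ → exampleRing p} (hu : u ∈ U) (hu0 : u ≠ 0) {n : ℕ} {z : Λ → ℚ⟦X⟧}
    (hz : ∀ i, (u i : ℚ⟦X⟧) = X ^ n * z i)
    (hunb : (fun i => constantCoeff (z i)) ∉ boundedFamilies p Λ) :
    ∃ V : Submodule (exampleRing p) (Λ → exampleRing p), IsCompl U V := by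
  obtain ⟨φ, hφz, hφ⟩ := Submodule.exists_le_ker_of_notMem hunb
  set Φ := coeffwiseMap φ
  have hΦz : constantCoeff (Φ z) ≠ 0 := by rwa [constantCoeff_coeffwiseMap]
  have hΦ (m : Λ → exampleRing p) : constantCoeff (Φ fun i => (m i : ℚ⟦X⟧)) = 0 := by
    rw [constantCoeff_coeffwiseMap]
    exact hφ ⟨1, fun i => (mem_exampleRing_iff_padicNorm _).1 (m i).2⟩
  let π : (Λ → exampleRing p) →ₗ[exampleRing p] (Λ → exampleRing p) :=
    { toFun := fun m i => ⟨Φ (fun i => (m i : ℚ⟦X⟧)) * ((Φ z)⁻¹ * z i),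
        mem_exampleRing_of_constantCoeff_eq_zero (by rw [map_mul, hΦ, zero_mul])⟩
      map_add' := fun m m' => by
        have h := map_add Φ (fun i => (m i : ℚ⟦X⟧)) fun i => (m' i : ℚ⟦X⟧)
        ext1 i
        exact Subtype.ext ((congrArg (· * ((Φ z)⁻¹ * z i)) h).trans (add_mul _ _ _))
      map_smul' := fun r m => by
        have h := map_smul Φ (r : ℚ⟦X⟧) fun i => (m i : ℚ⟦X⟧)
        ext1 i
        exact Subtype.ext ((congrArg (· * ((Φ z)⁻¹ * z i)) h).trans (mul_assoc _ _ _)) }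
  have hX : (⟨X, X_mem_exampleRing⟩ : exampleRing p) ^ n ≠ 0 :=
    pow_ne_zero n fun h => X_ne_zero (congrArg Subtype.val h)
  refine exists_isCompl_of_fixed_ne_zero hU π (fun m => hp.mem_of_smul_mem hX ?_) hu hu0 ?_
  · -- `Xⁿ π(m)` is the multiple of `u = Xⁿ z` by an element of `J`.
    have hmem : Φ (fun i => (m i : ℚ⟦X⟧)) * (Φ z)⁻¹ ∈ exampleRing p :=
      mem_exampleRing_of_constantCoeff_eq_zero (by rw [map_mul, hΦ, zero_mul])
    convert! U.smul_mem ⟨_, hmem⟩ hu using 1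
    ext1 i
    refine Subtype.ext ?_
    simp only [Pi.smul_apply, smul_eq_mul, Subring.coe_mul, Subring.coe_pow, hz, π,
      LinearMap.coe_mk, AddHom.coe_mk]
    ring
  · have h : Φ (fun i => (u i : ℚ⟦X⟧)) = X ^ n * Φ z :=
      (congrArg Φ (funext hz)).trans (map_smul Φ (X ^ n : ℚ⟦X⟧) z)
    ext1 i
    refine Subtype.ext ?_
    simp only [π, LinearMap.coe_mk, AddHom.coe_mk]
    rw [h, hz]
    linear_combination (X ^ n * z i) * PowerSeries.mul_inv_cancel (Φ z) hΦz

theorem isSeparableModule_exampleRing (Λ : Type u) :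
    IsSeparableModule (exampleRing p) (Λ → exampleRing p) := by
  intro U hp hU
  rcases eq_or_ne U ⊥ with rfl | hne
  · exact ⟨⊤, isCompl_bot_top⟩
  obtain ⟨u, hu, hu0⟩ := Submodule.exists_mem_ne_zero_of_ne_bot hne
  have hu0' : (fun i => (u i : ℚ⟦X⟧)) ≠ 0 := fun h =>
    hu0 (funext fun i => Subtype.ext (congrFun h i))
  obtain ⟨n, z, hz, i, hi⟩ := exists_family_eq_X_pow_mul hu0'
  by_cases hb : (fun i => constantCoeff (z i)) ∈ boundedFamilies p Λ
  · obtain ⟨j, hj, hmax⟩ := exists_max_padicNorm hb hi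
    refine exists_isCompl_of_coordinate_dvd hp hU hu (i := j) (fun h => ?_)
      fun l => exampleRing_dvd_of_eq_X_pow_mul n (hz j) (hz l) hj (hmax l)
    have h0 := hz j
    simp only [h, Subring.coe_zero] at h0
    have hz0 : z j = 0 := (mul_eq_zero.1 h0.symm).resolve_left (pow_ne_zero n X_ne_zero)
    exact hj (by simp [hz0])
  · exact exists_isCompl_of_unbounded hp hU hu hu0 hz hb

end Separability

theorem mainTheorem3 (p : ℕ) [Fact p.Prime] :
    ∃ _ : ValuationRing (exampleRing p),
      (∀ f : exampleRing p,
        f ∈ idealJ (exampleRing p) ↔ PowerSeries.X ∣ (f : PowerSeries ℚ)) ∧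
      (∃ _ : (idealJ (exampleRing p)).IsPrime,
        Nonempty ((exampleRing p ⧸ idealJ (exampleRing p)) ≃+* Localization.AtPrime (pIdeal p)) ∧
        Nonempty (Localization.AtPrime (idealJ (exampleRing p)) ≃ₐ[exampleRing p] PowerSeries ℚ) ∧
        IsMaximalValuationRing (Localization.AtPrime (idealJ (exampleRing p)))) ∧
      ¬ IsMaximalValuationRing (exampleRing p) ∧
      ¬ IsDiscreteValuationRing (exampleRing p) ∧
      (∀ Λ : Type u, IsSeparableModule (exampleRing p) (Λ → exampleRing p)) ∧
      ¬ (∀ (S : Type) [CommRing S] [IsDomain S] [ValuationRing S],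
          (∀ Λ : Type u, IsSeparableModule S (Λ → S)) →
            IsMaximalValuationRing S ∨ IsDiscreteValuationRing S) := by
  refine ⟨exampleRing_valuationRing, fun f => (mem_idealJ_iff f).trans X_dvd_iff.symm,
    ⟨idealJ_exampleRing_isPrime p, nonempty_quotient_idealJ_equiv p,
      nonempty_localization_idealJ_equiv p, ?_⟩,
    not_isMaximalValuationRing_exampleRing p, not_isDiscreteValuationRing_exampleRing p,
    isSeparableModule_exampleRing, fun h => ?_⟩
  · obtain ⟨e⟩ := nonempty_localization_idealJ_equiv p
    exact isMaximalValuationRing_of_ringEquiv_powerSeries e.toRingEquiv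
  · exact (h (exampleRing p) isSeparableModule_exampleRing).elim
      (not_isMaximalValuationRing_exampleRing p) (not_isDiscreteValuationRing_exampleRing p)
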